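/- **Theorem 4.1.** Let $K$ be a field of characteristic $0$ and let $\mathfrak g$ be a finite-dimensional simple Lie algebra over $K$ with a splitting Cartan subalgebra $\mathfrak h$, of rank $n=\dim_K\mathfrak h$. Let $R\subset\mathfrak h^*$ be its root system, fix a base of $R$, let $R^+=\{\alpha_1,\dots,\alpha_D\}$ be a listing of the positive roots, and fix a Chevalley basis of $\mathfrak g$, consisting of the simple coroots and of root vectors $X_\alpha$ $(\alpha\in R)$; write $H_\alpha=[X_\alpha,X_{-\alpha}]$ for the coroot of $\alpha$ and $Y_\alpha=X_{-\alpha}$ for $\alpha\in R^+$. Let $\mathfrak g_{\mathbb Z}$ be the $\mathbb Z$-span of the Chevalley basis. For a commutative ring $A$ put $\mathfrak g_A=A\otimes_{\mathbb Z}\mathfrak g_{\mathbb Z}=\mathfrak l_A\oplus\mathfrak h_A\oplus\mathfrak u_A$, where $\mathfrak l_A$ is spanned by the $Y_\alpha$, $\mathfrak u_A$ by the $X_\alpha$ $(\alpha\in R^+)$ and $\mathfrak h_A$ by the simple coroots. Let $\Bbbk$ be any field, so that $\mathfrak g_\Bbbk$ is the Lie algebra of the simply-connected Chevalley group over $\Bbbk$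 with root system $R$. Let $\mathbb U$ be the unipotent radical of its positive Borel subgroup, identified with $\mathbb A^D$ by $\Psi(x_1,\dots,x_D)=\lambda_{\alpha_1}(x_1)\cdots\lambda_{\alpha_D}(x_D)$, where $\mathsf{Ad}_{\lambda_\alpha(t)}=\exp(t\,\mathrm{ad}\,X_\alpha)=\sum_m t^m(\mathrm{ad}\,X_\alpha)^m/m!$. For $u\in\mathbb U$ put $\varphi_u=\mathrm{proj}_{\mathfrak h}\circ\mathsf{Ad}_u|_{\mathfrak l}\colon\mathfrak l\to\mathfrak h$. Let $\mathcal I_{\mathcal B}\subset\Bbbk[x_1,\dots,x_D]$ be the ideal of the pull-back under $\varphi\circ\Psi$ of the scheme of linear maps $\mathfrak l\to\mathfrak h$ that are not of maximal rank, that is, the ideal generated by the $n\times n$ minors of a matrix of $\varphi_{\Psi(x_1,\dots,x_D)}$. Let $\mathscr A=\{\Omega_1,\dots,\Omega_D\}$, with $\Omega_i=\ker\alpha_i\subset\mathfrak h$, be the Coxeter arrangement. Its nerve complex $\Delta(\mathfrak g)$ is the simplicial complex on $\{1,\dots,D\}$ whose faces are the empty set and the subsets of the sets $F_\pi=\{i\mid\pi\subseteq\Omega_i\}$,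 where $\pi$ runs over the intersections of members of $\mathscr A$ other than $\mathfrak h$ (the empty intersection) and $\bigcap_i\Omega_i$. Let $I_{\Delta(\mathfrak g)}\subset\Bbbk[x_1,\dots,x_D]$ be the Stanley–Reisner ideal, generated by the monomials $\prod_{i\in s}x_i$ with $s$ not a face of $\Delta(\mathfrak g)$. Then: 1. $\mathcal I_{\mathcal B}$ is a monomial ideal, over every field $\Bbbk$. 2. Assume that $\Bbbk$ has characteristic $0$, or has characteristic $p>0$ such that for no set $S$ of coroots the quotient of the coroot lattice by the subgroup generated by $S$ has $p$-torsion. Then $I_{\Delta(\mathfrak g)}\subseteq\mathcal I_{\mathcal B}$. 3. A subset $s\subseteq\{1,\dots,D\}$ is a minimal non-face of $\Delta(\mathfrak g)$ if and only if it has $n$ elements and $\{\alpha_i\mid i\in s\}$ is a basis of $\mathfrak h^*$. -/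

import Mathlib

open LieAlgebra LieAlgebra.IsKilling LieModule Module

noncomputable section

namespace LULU

/-! ### Monomial ideals, ideals of maximal minors, Stanley–Reisner ideals -/

/-- An ideal of a polynomial ring is monomial if it is generated by monomials. -/
def IsMonomialIdeal {σ R : Type*} [CommRing R] (I : Ideal (MvPolynomial σ R)) : Prop :=
  ∃ S : Set (σ →₀ ℕ), I = Ideal.span ((fun m => MvPolynomial.monomial m (1 : R)) '' S)

/-- For a matrix with `n` rows (read as a linear map from a free module with basis indexed by the
columns to a free module of rank `n`), the ideal generated by its `n × n` minors: this is the ideal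
of the closed subscheme of the base where the linear map does not have maximal rank `n`. -/
def maximalMinorsIdeal {m c A : Type*} [Fintype m] [DecidableEq m] [CommRing A]
    (M : Matrix m c A) : Ideal A :=
  Ideal.span (Set.range fun f : m → c => (M.submatrix id f).det)

/-- The Stanley–Reisner ideal of a simplicial complex `Δ` with vertices indexed by `σ`: it is
generated by the squarefree monomials `∏ i ∈ s, x i`, where `s` runs over the (nonempty) subsets
that are not faces of `Δ`. (The faces of a `PreAbstractSimplicialComplex` are nonempty by
convention; the empty set counts as a face.) -/
def stanleyReisnerIdeal {σ : Type*} (R : Type*) [CommRing R] (Δ : PreAbstractSimplicialComplex σ) :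
    Ideal (MvPolynomial σ R) :=
  Ideal.span {f | ∃ s : Finset σ, s.Nonempty ∧ s ∉ Δ ∧ f = ∏ i ∈ s, MvPolynomial.X i}

/-- A minimal non-face of a simplicial complex. -/
def IsMinimalNonface {σ : Type*} (Δ : PreAbstractSimplicialComplex σ) (s : Finset σ) : Prop :=
  Minimal (fun t : Finset σ => t.Nonempty ∧ t ∉ Δ) s

/-! ### The nerve complex of a central arrangement -/

section Arrangement

variable {F V σ : Type*} [Field F] [AddCommGroup V] [Module F V]

/-- The elements of the intersection lattice of the central arrangement `Ω`: all intersections of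
members of the arrangement (the empty intersection being the ambient space). -/
def intersectionLattice (Ω : σ → Submodule F V) : Set (Submodule F V) :=
  Set.range fun s : Set σ => ⨅ i ∈ s, Ω i

/-- The intersection lattice without its minimal element (the ambient space) and without its
maximal element (the intersection of all the hyperplanes); the order is reverse inclusion. -/
def properFlats (Ω : σ → Submodule F V) : Set (Submodule F V) :=
  intersectionLattice Ω \ {⊤, ⨅ i, Ω i}

/-- The nerve complex of the central arrangement `Ω`: its faces are the subsets of the sets
`F_π = {i | π ⊆ Ω i}`, for `π` a proper flat. -/
def nerveComplex (Ω : σ → Submodule F V) : PreAbstractSimplicialComplex σ where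
  faces := {s | s.Nonempty ∧ ∃ π ∈ properFlats Ω, ∀ i ∈ s, π ≤ Ω i}
  isRelLowerSet_faces := by
    rintro s ⟨hs, π, hπ, h⟩
    exact ⟨hs, fun t hts ht => ⟨ht, π, hπ, fun i hi => h i (hts hi)⟩⟩

end Arrangement

/-! ### Chevalley bases and the Lie algebra of the simply-connected Chevalley group -/

section Chevalley

variable {K L : Type*} [Field K] [CharZero K] [LieRing L] [LieAlgebra K L] [IsKilling K L]
  [FiniteDimensional K L] {H : LieSubalgebra K L} [H.IsCartanSubalgebra]
  [IsTriangularizable K H L]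

/-- The root `-α`. -/
def negRoot (α : H.root) : H.root := ⟨-α.1, by
  simpa using (Weight.IsNonZero.neg (H.isNonZero_coe_root α))⟩

/-- A Chevalley basis of the split semisimple Lie algebra `L`, with respect to the splitting Cartan
subalgebra `H` and the base `b` of its root system: a basis consisting of the simple coroots and of
root vectors `X α`, one for each root `α`, such that `[X α, X (-α)]` is the coroot of `α` and
`[X α, X β] = ± (r + 1) X (α + β)` whenever `α`, `β` and `α + β` are roots, where `r` is the largest
integer such that `β - r α` is a root. -/
structure ChevalleyBasis (b : (rootSystem H).Base) where
  basis : Module.Basis (b.support ⊕ H.root) K L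
  basis_simple (i : b.support) : basis (Sum.inl i) = ((coroot (i : H.root).1 : H) : L)
  basis_root_mem (α : H.root) : basis (Sum.inr α) ∈ rootSpace H α.1
  lie_neg (α : H.root) :
    ⁅basis (Sum.inr α), basis (Sum.inr (negRoot α))⁆ = ((coroot α.1 : H) : L)
  lie_add (α β γ : H.root) (h : (γ.1 : H → K) = (α.1 : H → K) + (β.1 : H → K)) :
    ∃ ε : ℤˣ, ⁅basis (Sum.inr α), basis (Sum.inr β)⁆ =
      ((ε : ℤ) * ((chainBotCoeff α.1 β.1 : ℤ) + 1)) • basis (Sum.inr γ)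

variable {b : (rootSystem H).Base} (C : ChevalleyBasis b)

/-- The matrix in the Chevalley basis of the divided power `(ad X_α) ^ m / m!`. Its entries are
integers (the `ℤ`-span of a Chevalley basis is stable under the divided powers), and they are
recorded here as integers: `Function.invFun (Int.cast : ℤ → K)` recovers the integer `z` from its
image in the field `K` of characteristic zero. -/
def ChevalleyBasis.adDivPow (α : H.root) (m : ℕ) :
    Matrix (b.support ⊕ H.root) (b.support ⊕ H.root) ℤ := by
  classical
  exact (LinearMap.toMatrix C.basis C.basis
    ((m.factorial : K)⁻¹ • (ad K L (C.basis (Sum.inr α))) ^ m)).map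
      (Function.invFun (Int.cast : ℤ → K))

/-- Let `𝔤_ℤ` be the `ℤ`-span of the Chevalley basis, and for a commutative ring `R` let
`𝔤_R = R ⊗ 𝔤_ℤ`; when `R` is a field, this is the Lie algebra of the simply-connected Chevalley group
over `R`, and its Cartan subalgebra `𝔥_R` is spanned by the simple coroots. This is the matrix, in
the Chevalley basis, of the automorphism `Ad (λ_α(t)) = exp (t ad X_α) = ∑ t ^ m (ad X_α) ^ m / m!`
of `𝔤_R`, where `λ_α` is the one-parameter unipotent subgroup of the root `α` and `t ∈ R`. The sum
is finite, since the nilpotent endomorphism `ad X_α` satisfies `(ad X_α) ^ dim L = 0`. -/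
def ChevalleyBasis.adRootGroup (R : Type*) [CommRing R] (α : H.root) (t : R) :
    Matrix (b.support ⊕ H.root) (b.support ⊕ H.root) R :=
  ∑ m ∈ Finset.range (finrank K L + 1), t ^ m • (C.adDivPow α m).map (Int.cast : ℤ → R)

variable {D : ℕ} (e : Fin D ≃ {α : H.root // b.IsPos α})

/-- The matrix of `Ad u` on `𝔤_R`, for the point `u = λ_{α_1}(t_1) ⋯ λ_{α_D}(t_D)` of the unipotent
radical `U(R)`, where `e` is a listing `α_1, …, α_D` of the positive roots. The map
`t ↦ λ_{α_1}(t_1) ⋯ λ_{α_D}(t_D)` is the isomorphism `Ψ : 𝔸^D ≅ U`. -/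
def ChevalleyBasis.adUnipotent (R : Type*) [CommRing R] (t : Fin D → R) :
    Matrix (b.support ⊕ H.root) (b.support ⊕ H.root) R := by
  classical
  exact (List.ofFn fun i => C.adRootGroup R (e i).1 (t i)).prod

/-- The matrix of `φ_u = proj_𝔥 ∘ Ad u |_𝔩 : 𝔩_R → 𝔥_R` at the point `u = Ψ(t)` of `U(R)`, with
respect to the basis `Y_{α_1}, …, Y_{α_D}` of `𝔩_R` (where `Y_α = X_{-α}`) and the basis of `𝔥_R` given
by the simple coroots. -/
def ChevalleyBasis.phi (R : Type*) [CommRing R] (t : Fin D → R) :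
    Matrix b.support (Fin D) R :=
  (C.adUnipotent e R t).submatrix Sum.inl fun i => Sum.inr (negRoot (e i).1)

/-- The ideal `I_𝓑` of `k[x_1, …, x_D]`: the ideal of the pull-back under `φ ∘ Ψ : 𝔸^D → Hom(𝔩, 𝔥)`
of the scheme of linear maps that do not have maximal rank. It is obtained from the matrix of
`φ` at the universal point `(x_1, …, x_D)` of `𝔸^D`. -/
def ChevalleyBasis.idealB (k : Type*) [Field k] : Ideal (MvPolynomial (Fin D) k) := by
  classical
  exact maximalMinorsIdeal (C.phi e (MvPolynomial (Fin D) k) MvPolynomial.X)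

/-- The Coxeter arrangement of the hyperplanes `Ω_α = {h ∈ H | α h = 0}`, for `α` a positive
root. -/
def coxeterArrangement : Fin D → Submodule K H :=
  fun i => LinearMap.ker (Weight.toLinear K H L (e i).1.1)

/-- `p` is a torsion integer of the coroots if, for some set `S` of coroots, the quotient of the
coroot lattice by the subgroup generated by `S` contains a nonzero element killed by `p`. -/
def HasCorootTorsion (H : LieSubalgebra K L) [H.IsCartanSubalgebra] [IsTriangularizable K H L]
    (p : ℕ) : Prop :=
  ∃ S : Set H.root, ∃ v ∈ AddSubgroup.closure (Set.range fun α : H.root => (coroot α.1 : H)),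
    v ∉ AddSubgroup.closure ((fun α : H.root => (coroot α.1 : H)) '' S) ∧
    p • v ∈ AddSubgroup.closure ((fun α : H.root => (coroot α.1 : H)) '' S)

end Chevalley

end LULU

end

/-!
The entry of `Ad u` from `𝔩` to `𝔥` is governed by one observation about weights: `Ad (λ_α(t))` has
a component in the weight space `0` only on `𝔥` itself, where it is the identity, and on `X (-α)`,
which it sends to `t H_α`. Expanding `λ_{α_1}(x_1) ⋯ λ_{α_D}(x_D) Y_β` from the left therefore gives
`φ(Y_β) = ∑ i, p_{iβ} x_i H_{α_i}`, where `p_{iβ}` is the coefficient of `Y_{α_i}` in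
`λ_{α_{i+1}}(x_{i+1}) ⋯ λ_{α_D}(x_D) Y_β`. As the `λ_α` with `α` positive raise heights, the matrix
`(p_{iβ})` is unitriangular with respect to the height, hence of determinant `1`, and the ideal of
maximal minors of `φ` equals that of the matrix with columns `x_i H_{α_i}`
(`exists_phi_eq_scaleColumns_mul`, `maximalMinorsIdeal_mul_of_isUnit_det`). The minors of the latter
are scalars times squarefree monomials, or zero, so over a field they generate a monomial ideal. The
argument uses the integrality only of the coordinates of the coroots, not of the `p_{iβ}`.

The monomial of `n` positive roots lies in the ideal as soon as the determinant of their coroots in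
terms of the simple coroots is nonzero in `k`. If the roots are linearly independent, this
determinant is a nonzero integer, and a prime `p` dividing it produces `p`-torsion in the quotient
of the coroot lattice by the subgroup that these coroots generate
(`hasCorootTorsion_of_dvd_det`).

A nonempty set of positive roots is a non-face of the nerve complex exactly if the common kernel of
the roots is zero, that is, if they span the dual of `𝔥`
(`nonempty_and_notMem_nerveComplex_iff`). Minimal spanning families are bases, and every spanning
family contains one; this gives the description of the minimal non-faces and reduces the inclusion
of the Stanley–Reisner ideal to the monomials of bases.
-/

namespace LULU

/-! ### Ideals of maximal minors -/

section Minors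

variable {m c d A : Type*} [Fintype m] [DecidableEq m] [CommRing A]

/-- The columns of `M * Q` are combinations of the columns of `M`, so by multilinearity of the
determinant every maximal minor of `M * Q` is a combination of maximal minors of `M`. -/
theorem maximalMinorsIdeal_mul_le [Fintype c] (M : Matrix m c A) (Q : Matrix c d A) :
    maximalMinorsIdeal (M * Q) ≤ maximalMinorsIdeal M := by
  classical
  refine Ideal.span_le.2 ?_
  rintro _ ⟨f, rfl⟩
  have key : ((M * Q).submatrix id f).det =
      ∑ g : m → c, (∏ j, Q (g j) (f j)) * (M.submatrix id g).det := by
    rw [← Matrix.det_transpose]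
    have h : ((M * Q).submatrix id f).transpose =
        fun j => ∑ x : c, Q x (f j) • fun i => M i x := by
      ext j i
      simp [Matrix.mul_apply, mul_comm]
    rw [h]
    change Matrix.detRowAlternating.toMultilinearMap _ = _
    rw [MultilinearMap.map_sum]
    refine Finset.sum_congr rfl fun g _ => ?_
    rw [MultilinearMap.map_smul_univ, smul_eq_mul]
    congr 1
    exact Matrix.det_transpose (M.submatrix id g)
  dsimp only
  rw [key]
  exact Ideal.sum_mem _ fun g _ => Ideal.mul_mem_left _ _ (Ideal.subset_span ⟨g, rfl⟩)

theorem maximalMinorsIdeal_mul_of_isUnit_det [Fintype c] [DecidableEq c] (M : Matrix m c A)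
    (P : Matrix c c A) (hP : IsUnit P.det) :
    maximalMinorsIdeal (M * P) = maximalMinorsIdeal M := by
  refine le_antisymm (maximalMinorsIdeal_mul_le M P) ?_
  have h := maximalMinorsIdeal_mul_le (M * P) P⁻¹
  rwa [Matrix.mul_assoc, Matrix.mul_nonsing_inv P hP, Matrix.mul_one] at h

/-- The matrix whose `j`-th column is the `j`-th column of `N` times the variable `X j`. -/
noncomputable def scaleColumns {k : Type*} [CommRing k] (N : Matrix m c k) :
    Matrix m c (MvPolynomial c k) :=
  Matrix.of fun i j => MvPolynomial.X j * MvPolynomial.C (N i j)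

theorem det_scaleColumns_submatrix {k : Type*} [CommRing k] (N : Matrix m c k) (f : m → c) :
    ((scaleColumns N).submatrix id f).det =
      (∏ j, MvPolynomial.X (f j)) * MvPolynomial.C (N.submatrix id f).det := by
  rw [RingHom.map_det, ← Matrix.det_mul_row]
  rfl

theorem prod_X_mem_maximalMinorsIdeal_scaleColumns {k : Type*} [Field k] (N : Matrix m c k)
    {f : m → c} (h : (N.submatrix id f).det ≠ 0) :
    ∏ j, MvPolynomial.X (f j) ∈ maximalMinorsIdeal (scaleColumns N) := by
  have hm : ((scaleColumns N).submatrix id f).det ∈ maximalMinorsIdeal (scaleColumns N) :=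
    Ideal.subset_span ⟨f, rfl⟩
  have h' := Ideal.mul_mem_right (MvPolynomial.C (N.submatrix id f).det⁻¹) _ hm
  rwa [det_scaleColumns_submatrix, mul_assoc, ← map_mul, mul_inv_cancel₀ h, map_one,
    mul_one] at h'

/-- The maximal minors of a matrix over a field whose columns are scaled by independent variables
are scalar multiples of monomials, so they generate a monomial ideal. -/
theorem isMonomialIdeal_maximalMinorsIdeal_scaleColumns {k : Type*} [Field k] (N : Matrix m c k) :
    IsMonomialIdeal (maximalMinorsIdeal (scaleColumns N)) := by
  have hX (f : m → c) : (∏ j, MvPolynomial.X (f j) : MvPolynomial c k) =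
      MvPolynomial.monomial (∑ j, Finsupp.single (f j) 1) 1 := by
    rw [MvPolynomial.monomial_sum_one]
    rfl
  refine ⟨{v | ∃ f : m → c, (N.submatrix id f).det ≠ 0 ∧ v = ∑ j, Finsupp.single (f j) 1},
    le_antisymm (Ideal.span_le.2 ?_) (Ideal.span_le.2 ?_)⟩
  · rintro _ ⟨f, rfl⟩
    dsimp only
    rw [det_scaleColumns_submatrix, hX]
    by_cases h : (N.submatrix id f).det = 0
    · simp [h]
    · exact Ideal.mul_mem_right _ _ (Ideal.subset_span ⟨_, ⟨f, h, rfl⟩, rfl⟩)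
  · rintro _ ⟨_, ⟨f, h, rfl⟩, rfl⟩
    dsimp only
    rw [← hX]
    exact prod_X_mem_maximalMinorsIdeal_scaleColumns N h

end Minors

/-! ### Matrices that are unitriangular with respect to a height function -/

/-- A square matrix is unitriangular with respect to an integer-valued height on its index set if
its diagonal entries are `1` and its other nonzero entries `M i j` satisfy `ht j < ht i`. In
contrast with `Matrix.BlockTriangular`, distinct indices of equal height give the entry `0`. -/
def IsUnitriangular {ι A : Type*} [CommRing A] (ht : ι → ℤ) (M : Matrix ι ι A) : Prop :=
  (∀ i, M i i = 1) ∧ ∀ i j, i ≠ j → M i j ≠ 0 → ht j < ht i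

section Unitriangular

variable {ι A : Type*} [CommRing A] {ht : ι → ℤ}

theorem IsUnitriangular.one [DecidableEq ι] : IsUnitriangular ht (1 : Matrix ι ι A) :=
  ⟨fun i => by simp, fun i j h h' => absurd (Matrix.one_apply_ne h) h'⟩

theorem IsUnitriangular.mul [Fintype ι] {M N : Matrix ι ι A} (hM : IsUnitriangular ht M)
    (hN : IsUnitriangular ht N) : IsUnitriangular ht (M * N) := by
  refine ⟨fun i => ?_, fun i j hij h => ?_⟩
  · rw [Matrix.mul_apply, Finset.sum_eq_single i, hM.1, hN.1, one_mul]
    · intro z _ hz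
      by_contra h
      have h1 := hM.2 i z hz.symm (left_ne_zero_of_mul h)
      have h2 := hN.2 z i hz (right_ne_zero_of_mul h)
      exact lt_asymm h1 h2
    · simp
  · rw [Matrix.mul_apply] at h
    obtain ⟨z, -, hz⟩ := Finset.exists_ne_zero_of_sum_ne_zero h
    rcases eq_or_ne i z with rfl | hiz
    · exact hN.2 _ _ hij (right_ne_zero_of_mul hz)
    rcases eq_or_ne z j with rfl | hzj
    · exact hM.2 _ _ hij (left_ne_zero_of_mul hz)
    · exact (hN.2 _ _ hzj (right_ne_zero_of_mul hz)).trans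
        (hM.2 _ _ hiz (left_ne_zero_of_mul hz))

theorem IsUnitriangular.list_prod [Fintype ι] [DecidableEq ι] {l : List (Matrix ι ι A)}
    (h : ∀ M ∈ l, IsUnitriangular ht M) : IsUnitriangular ht l.prod := by
  induction l with
  | nil => simpa using IsUnitriangular.one
  | cons M l ih =>
    rw [List.prod_cons]
    exact (h M (by simp)).mul (ih fun N hN => h N (by simp [hN]))

theorem IsUnitriangular.det [Fintype ι] [DecidableEq ι] {M : Matrix ι ι A}
    (hM : IsUnitriangular ht M) : M.det = 1 := by
  have hb : M.BlockTriangular (fun i => OrderDual.toDual (ht i)) := by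
    intro i j hij
    by_contra h
    rcases eq_or_ne i j with rfl | hne
    · exact lt_irrefl _ hij
    · exact lt_asymm (hM.2 i j hne h) hij
  rw [hb.det]
  refine Finset.prod_eq_one fun a _ => ?_
  have : M.toSquareBlock (fun i => OrderDual.toDual (ht i)) a = 1 := by
    ext ⟨i, hi⟩ ⟨j, hj⟩
    rcases eq_or_ne i j with rfl | hne
    · simpa [Matrix.toSquareBlock, Matrix.toSquareBlockProp] using hM.1 i
    · have h0 : M i j = 0 := by
        by_contra h
        have := hM.2 i j hne h
        have h2 : ht i = ht j := OrderDual.toDual.injective (hi.trans hj.symm)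
        omega
      simpa [Matrix.toSquareBlock, Matrix.toSquareBlockProp, Matrix.one_apply, hne] using h0
  rw [this, Matrix.det_one]

/-- Suppose that left multiplication by the unitriangular matrix `A i` changes the `s`-th entry of a
vector only by adding `N s i` times its `z i`-th entry, for every `s ∈ S`. Then the rows `s ∈ S` of
`A 0 * A 1 * ⋯` are those of the identity plus the sum over `i` of `N s i` times the row `z i` of a
unitriangular matrix `Q i`, namely of the product of the factors that follow `A i`. -/
theorem exists_isUnitriangular_ofFn_prod_apply {ι R : Type*} [Fintype ι] [DecidableEq ι]
    [CommRing R] {ht : ι → ℤ} {S : Set ι} {D : ℕ} (A : Fin D → Matrix ι ι R)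
    (hA : ∀ i, IsUnitriangular ht (A i)) (N : ι → Fin D → R) (z : Fin D → ι)
    (hrow : ∀ s ∈ S, ∀ i, ∀ v : ι → R, (A i).mulVec v s = v s + N s i * v (z i)) :
    ∃ Q : Fin D → Matrix ι ι R, (∀ i, IsUnitriangular ht (Q i)) ∧ ∀ s ∈ S, ∀ y,
      (List.ofFn A).prod s y = (1 : Matrix ι ι R) s y + ∑ i, N s i * Q i (z i) y := by
  induction D with
  | zero => exact ⟨fun _ => 1, fun _ => IsUnitriangular.one, fun s _ y => by simp⟩
  | succ D ih =>
    obtain ⟨Q, hQ, h⟩ := ih (fun i => A i.succ) (fun i => hA _) (fun s i => N s i.succ)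
      (fun i => z i.succ) (fun s hs i v => hrow s hs _ v)
    refine ⟨Fin.cons (List.ofFn fun i => A i.succ).prod Q, ?_, fun s hs y => ?_⟩
    · refine Fin.cases ?_ fun i => ?_
      · rw [Fin.cons_zero]
        refine IsUnitriangular.list_prod fun M hM => ?_
        obtain ⟨i, rfl⟩ := List.mem_ofFn.1 hM
        exact hA _
      · rw [Fin.cons_succ]
        exact hQ i
    · rw [List.ofFn_succ, List.prod_cons, Fin.sum_univ_succ]
      have h1 := hrow s hs 0 (fun x => (List.ofFn fun i => A i.succ).prod x y)
      rw [h s hs y] at h1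
      refine Eq.trans ?_ (h1.trans ?_)
      · rfl
      · simp only [Fin.cons_zero, Fin.cons_succ]
        ring

end Unitriangular

/-! ### The nerve complex of an arrangement of kernels of linear forms -/

section Nerve

variable {F V σ : Type*} [Field F] [AddCommGroup V] [Module F V] {f : σ → Dual F V}

theorem iInf_ker_eq_dualCoannihilator_span (s : Set σ) :
    ⨅ i ∈ s, LinearMap.ker (f i) = (Submodule.span F (f '' s)).dualCoannihilator := by
  ext v
  rw [← SetLike.mem_coe, ← SetLike.mem_coe, Submodule.coe_dualCoannihilator_span]
  simp

theorem exists_finset_subset_linearIndepOn_span_eq_top {s : Finset σ}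
    (hs : Submodule.span F (f '' (s : Set σ)) = ⊤) :
    ∃ t ⊆ s, LinearIndepOn F f (t : Set σ) ∧ Submodule.span F (f '' (t : Set σ)) = ⊤ := by
  obtain ⟨t, hts, -, hst, ht⟩ := exists_linearIndepOn_extension
    (linearIndepOn_empty F f) (Set.empty_subset (s : Set σ))
  lift t to Finset σ using s.finite_toSet.subset hts
  refine ⟨t, Finset.coe_subset.1 hts, ht, ?_⟩
  rw [eq_top_iff, ← hs]
  exact Submodule.span_le.2 hst

theorem card_eq_finrank_of_linearIndepOn_of_span_eq_top {s : Finset σ}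
    (hli : LinearIndepOn F f (s : Set σ)) (hs : Submodule.span F (f '' (s : Set σ)) = ⊤) :
    s.card = finrank F V := by
  have B : Basis (s : Set σ) F (Dual F V) := Basis.mk hli (by
    rw [← hs, ← Set.image_eq_range])
  rw [← Subspace.dual_finrank_eq, finrank_eq_card_basis B]
  simp

variable [FiniteDimensional F V]

theorem span_eq_top_iff_iInf_ker_eq_bot (s : Set σ) :
    Submodule.span F (f '' s) = ⊤ ↔ ⨅ i ∈ s, LinearMap.ker (f i) = ⊥ := by
  rw [iInf_ker_eq_dualCoannihilator_span]
  constructor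
  · intro h
    rw [h, Submodule.dualCoannihilator_top]
  · intro h
    rw [← Subspace.dualCoannihilator_dualAnnihilator_eq (W := Submodule.span F (f '' s)), h,
      Submodule.dualAnnihilator_bot]

theorem nonempty_and_notMem_nerveComplex_iff [Nontrivial V] (hf : ∀ i, f i ≠ 0)
    (hspan : Submodule.span F (Set.range f) = ⊤) (s : Finset σ) :
    (s.Nonempty ∧ s ∉ nerveComplex fun i => LinearMap.ker (f i)) ↔
      Submodule.span F (f '' (s : Set σ)) = ⊤ := by
  have hbot : ⨅ i, LinearMap.ker (f i) = ⊥ := by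
    rw [← Set.image_univ, span_eq_top_iff_iInf_ker_eq_bot] at hspan
    simpa using hspan
  have hmem : s ∈ nerveComplex (fun i => LinearMap.ker (f i)) ↔
      s.Nonempty ∧ ∃ π ∈ properFlats fun i => LinearMap.ker (f i),
        ∀ i ∈ s, π ≤ LinearMap.ker (f i) := Iff.rfl
  rw [hmem, span_eq_top_iff_iInf_ker_eq_bot]
  constructor
  · rintro ⟨hs, h⟩
    by_contra hne
    refine h ⟨hs, _, ⟨⟨(s : Set σ), rfl⟩, ?_⟩, fun i hi => iInf₂_le i (Finset.mem_coe.2 hi)⟩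
    rw [hbot]
    rintro (h1 | h1)
    · obtain ⟨i, hi⟩ := hs
      have h2 : (⊤ : Submodule F V) ≤ LinearMap.ker (f i) := by
        rw [← h1]
        exact iInf₂_le i (Finset.mem_coe.2 hi)
      exact hf i (LinearMap.ker_eq_top.1 (top_le_iff.1 h2))
    · exact hne h1
  · intro h
    constructor
    · rw [Finset.nonempty_iff_ne_empty]
      rintro rfl
      simp at h
    · rintro ⟨-, π, ⟨-, hπ⟩, hle⟩
      refine hπ (Or.inr ?_)
      rw [Set.mem_singleton_iff, hbot, eq_bot_iff, ← h]
      exact le_iInf₂ fun i hi => hle i (Finset.mem_coe.1 hi)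

theorem isMinimalNonface_nerveComplex_iff [Nontrivial V] (hf : ∀ i, f i ≠ 0)
    (hspan : Submodule.span F (Set.range f) = ⊤) (s : Finset σ) :
    IsMinimalNonface (nerveComplex fun i => LinearMap.ker (f i)) s ↔
      LinearIndepOn F f (s : Set σ) ∧ Submodule.span F (f '' (s : Set σ)) = ⊤ := by
  classical
  unfold IsMinimalNonface
  simp only [nonempty_and_notMem_nerveComplex_iff hf hspan]
  constructor
  · rintro ⟨hs, hmin⟩
    refine ⟨?_, hs⟩
    obtain ⟨t, hts, ht, htop⟩ := exists_finset_subset_linearIndepOn_span_eq_top hs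
    exact ht.mono (Finset.coe_subset.2 (hmin htop hts))
  · rintro ⟨hli, hs⟩
    refine ⟨hs, fun t ht hts i hi => ?_⟩
    by_contra hit
    refine hli.notMem_span hi (Submodule.span_mono (Set.image_mono ?_) (ht ▸ Submodule.mem_top))
    exact fun j hj => ⟨hts hj, fun h => hit (h ▸ hj)⟩

end Nerve

section Chevalley

variable {K L : Type*} [Field K] [CharZero K] [LieRing L] [LieAlgebra K L] [IsKilling K L]
  [FiniteDimensional K L] {H : LieSubalgebra K L} [H.IsCartanSubalgebra]
  [IsTriangularizable K H L] {b : (rootSystem H).Base}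

/-! ### Weights and heights of the Chevalley basis -/

/-- The weight of a member of the Chevalley basis: `0` for a simple coroot, `α` for `X α`. -/
noncomputable def basisWeight (b : (rootSystem H).Base) : b.support ⊕ H.root → Dual K H :=
  Sum.elim (fun _ => 0) fun α => (rootSystem H).root α

/-- The height of the weight of a member of the Chevalley basis. -/
noncomputable def basisHeight (b : (rootSystem H).Base) : b.support ⊕ H.root → ℤ :=
  Sum.elim (fun _ => 0) b.height

/-- The height of roots is the restriction of the linear form that is `1` at the simple roots. -/
theorem exists_dual_apply_basisWeight (b : (rootSystem H).Base) :
    ∃ f : Dual K H →ₗ[K] K, ∀ x, f (basisWeight b x) = basisHeight b x := by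
  refine ⟨b.toWeightBasis.constr K fun _ => (1 : K), ?_⟩
  rintro (x | α)
  · simp [basisWeight, basisHeight]
  · obtain ⟨g, -, -, hg⟩ := b.exists_root_eq_sum_int α
    have h1 (j : b.support) : b.toWeightBasis.constr K (fun _ => (1 : K))
        ((rootSystem H).root j) = 1 := by
      rw [← b.toWeightBasis_apply, Basis.constr_basis]
    simp only [basisWeight, basisHeight, Sum.elim_inr]
    rw [b.height_eq_sum hg, hg, map_sum, Int.cast_sum]
    refine Finset.sum_congr rfl fun j hj => ?_
    rw [map_zsmul, h1 ⟨j, hj⟩]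
    simp

theorem root_negRoot (α : H.root) :
    (rootSystem H).root (negRoot α) = -(rootSystem H).root α := by
  ext x
  simp [negRoot]

theorem negRoot_injective : Function.Injective (negRoot (H := H)) := by
  intro α β h
  have := congrArg (rootSystem H).root h
  rw [root_negRoot, root_negRoot, neg_inj] at this
  exact (rootSystem H).root.injective this

/-- The only negative multiple of a root `α` among the weights of the adjoint representation is
`-α`. -/
theorem eq_inr_negRoot_of_nsmul_root_add_basisWeight_eq_zero {α : H.root} {m : ℕ} (hm : m ≠ 0)
    {y : b.support ⊕ H.root} (h : m • (rootSystem H).root α + basisWeight b y = 0) :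
    m = 1 ∧ y = Sum.inr (negRoot α) := by
  rcases y with s | β
  · simp only [basisWeight, Sum.elim_inl, add_zero] at h
    exact absurd h (smul_ne_zero hm ((rootSystem H).ne_zero α))
  · simp only [basisWeight, Sum.elim_inr] at h
    have hβ (x : H) : (rootSystem H).root β x = -(m : K) * (rootSystem H).root α x := by
      have hx := LinearMap.congr_fun h x
      simp only [LinearMap.add_apply, LinearMap.smul_apply, nsmul_eq_mul,
        LinearMap.zero_apply] at hx
      linear_combination hx
    have hm1 : m = 1 := by
      rcases eq_neg_one_or_eq_zero_or_eq_one_of_eq_smul α.1 β.1 (H.isNonZero_coe_root α)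
        (-(m : K)) (funext hβ) with h1 | h1 | h1
      · exact_mod_cast neg_inj.1 h1
      · exact absurd (by exact_mod_cast neg_eq_zero.1 h1) hm
      · have h2 : ((m + 1 : ℕ) : K) = 0 := by
          push_cast
          rw [← h1]
          ring
        exact absurd (Nat.cast_eq_zero.1 h2) (Nat.succ_ne_zero m)
    subst hm1
    refine ⟨rfl, congrArg Sum.inr ((rootSystem H).root.injective ?_)⟩
    rw [root_negRoot]
    ext x
    simpa using hβ x

namespace ChevalleyBasis

variable (C : ChevalleyBasis b)

theorem basis_mem_rootSpace (x : b.support ⊕ H.root) :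
    C.basis x ∈ rootSpace H (basisWeight b x) := by
  rcases x with s | α
  · rw [C.basis_simple]
    have h : ((coroot (s : H.root).1 : H) : L) ∈ H.toLieSubmodule := (coroot (s : H.root).1).2
    rw [← rootSpace_zero_eq K L H] at h
    exact h
  · exact C.basis_root_mem α

/-- A vector of weight `χ` is a combination of basis vectors of weight `χ`. -/
theorem basisWeight_eq_of_repr_ne_zero {χ : H → K} {v : L} (hv : v ∈ rootSpace H χ)
    {x : b.support ⊕ H.root} (hx : C.basis.repr v x ≠ 0) : (basisWeight b x : H → K) = χ := by
  funext h
  have key : (C.basis.coord x).comp (ad K L (h : L)) =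
      (basisWeight b x h) • C.basis.coord x := by
    refine C.basis.ext fun y => ?_
    have hy : ⁅(h : L), C.basis y⁆ = basisWeight b y h • C.basis y :=
      lie_eq_smul_of_mem_rootSpace (C.basis_mem_rootSpace y) h
    simp only [LinearMap.comp_apply, ad_apply, hy, LinearMap.smul_apply, map_smul,
      Basis.coord_apply, Basis.repr_self, smul_eq_mul]
    rcases eq_or_ne y x with rfl | hne
    · rfl
    · simp [Finsupp.single_eq_of_ne hne.symm]
  have h1 := LinearMap.congr_fun key v
  have hv' : ⁅(h : L), v⁆ = χ h • v := lie_eq_smul_of_mem_rootSpace hv h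
  simp only [LinearMap.comp_apply, ad_apply, hv', LinearMap.smul_apply, map_smul,
    Basis.coord_apply, smul_eq_mul] at h1
  exact (mul_right_cancel₀ hx h1).symm

/-! ### The root subgroups in the adjoint representation -/

theorem adDivPow_apply (α : H.root) (m : ℕ) (x y : b.support ⊕ H.root) :
    C.adDivPow α m x y = Function.invFun (Int.cast : ℤ → K) ((m.factorial : K)⁻¹ *
      C.basis.repr (((ad K L (C.basis (Sum.inr α))) ^ m) (C.basis y)) x) := by
  classical
  simp [adDivPow, LinearMap.toMatrix_apply]

theorem invFun_intCast (z : ℤ) : Function.invFun (Int.cast : ℤ → K) (z : K) = z :=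
  Function.leftInverse_invFun Int.cast_injective z

theorem adDivPow_zero [DecidableEq (b.support ⊕ H.root)] (α : H.root) : C.adDivPow α 0 = 1 := by
  ext x y
  rw [adDivPow_apply]
  have h : ((Nat.factorial 0 : K)⁻¹ * C.basis.repr (((ad K L (C.basis (Sum.inr α))) ^ 0)
      (C.basis y)) x) = ((if x = y then 1 else 0 : ℤ) : K) := by
    simp [Finsupp.single_apply, eq_comm]
  rw [h, invFun_intCast, Matrix.one_apply]

/-- The divided power `(ad X_α) ^ m / m!` raises weights by `m α`. -/
theorem basisWeight_eq_of_adDivPow_ne_zero {α : H.root} {m : ℕ} {x y : b.support ⊕ H.root}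
    (h : C.adDivPow α m x y ≠ 0) :
    basisWeight b x = m • (rootSystem H).root α + basisWeight b y := by
  rw [adDivPow_apply] at h
  have h0 : C.basis.repr (((ad K L (C.basis (Sum.inr α))) ^ m) (C.basis y)) x ≠ 0 := by
    intro h0
    rw [h0, mul_zero, ← Int.cast_zero, invFun_intCast] at h
    exact h rfl
  have hmem := toEnd_pow_apply_mem (C.basis_root_mem α) (C.basis_mem_rootSpace y) m
  exact DFunLike.coe_injective (C.basisWeight_eq_of_repr_ne_zero hmem h0)

/-- The coordinates of the coroot of `α` in the basis of simple coroots, recorded as integers (see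
`coroot_eq_sum_corootCoord`). -/
noncomputable def corootCoord (s : b.support) (α : H.root) : ℤ :=
  Function.invFun (Int.cast : ℤ → K) (C.basis.repr ((coroot α.1 : H) : L) (Sum.inl s))

theorem coroot_eq_sum_corootCoord (α : H.root) :
    (coroot α.1 : H) = ∑ s : b.support, C.corootCoord s α • (coroot (s : H.root).1 : H) := by
  have h := b.coroot_mem_span_int α
  rw [Set.image_eq_range, Submodule.mem_span_range_iff_exists_fun] at h
  obtain ⟨g, hg⟩ := h
  replace hg : ∑ s : b.support, g s • (coroot (s : H.root).1 : H) = coroot α.1 := hg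
  rw [← hg]
  refine Finset.sum_congr rfl fun s _ => ?_
  congr 1
  have h1 : ((coroot α.1 : H) : L) = ∑ s : b.support, (g s : K) • C.basis (Sum.inl s) := by
    rw [← hg]
    simp [C.basis_simple, Int.cast_smul_eq_zsmul]
  have h2 : C.basis.repr ((coroot α.1 : H) : L) (Sum.inl s) = (g s : K) := by
    rw [h1, map_sum, Finsupp.finsetSum_apply, Finset.sum_eq_single s]
    · simp
    · intro j _ hj
      simp [Finsupp.single_eq_of_ne (Sum.inl_injective.ne hj.symm)]
    · simp
  rw [corootCoord, h2, invFun_intCast]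

theorem adDivPow_one_inl (α : H.root) (s : b.support) :
    C.adDivPow α 1 (Sum.inl s) (Sum.inr (negRoot α)) = C.corootCoord s α := by
  rw [adDivPow_apply, corootCoord, ← C.lie_neg]
  simp

theorem adRootGroup_apply {R : Type*} [CommRing R] (α : H.root) (t : R)
    (x y : b.support ⊕ H.root) :
    C.adRootGroup R α t x y =
      ∑ m ∈ Finset.range (finrank K L + 1), t ^ m * (C.adDivPow α m x y : R) := by
  simp [adRootGroup, Matrix.sum_apply]

theorem isUnitriangular_adRootGroup {R : Type*} [CommRing R] {α : H.root} (hα : b.IsPos α)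
    (t : R) : IsUnitriangular (basisHeight b) (C.adRootGroup R α t) := by
  classical
  obtain ⟨f, hf⟩ := exists_dual_apply_basisWeight b
  have hlt {m : ℕ} (hm : m ≠ 0) {x y : b.support ⊕ H.root} (h : C.adDivPow α m x y ≠ 0) :
      basisHeight b y < basisHeight b x := by
    have h1 := congrArg f (C.basisWeight_eq_of_adDivPow_ne_zero h)
    have h2 : f ((rootSystem H).root α) = (b.height α : K) := hf (Sum.inr α)
    rw [map_add, map_nsmul, hf, hf, h2, nsmul_eq_mul] at h1
    have h3 : basisHeight b x = m * b.height α + basisHeight b y := by exact_mod_cast h1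
    have h4 : 0 < (m : ℤ) * b.height α := mul_pos (by omega) hα
    omega
  refine ⟨fun x => ?_, fun x y hxy h => ?_⟩
  · rw [adRootGroup_apply, Finset.sum_eq_single 0]
    · simp [adDivPow_zero]
    · intro m _ hm
      have h0 : C.adDivPow α m x x = 0 := by
        by_contra h
        exact lt_irrefl _ (hlt hm h)
      simp [h0]
    · simp
  · rw [adRootGroup_apply] at h
    obtain ⟨m, -, hm⟩ := Finset.exists_ne_zero_of_sum_ne_zero h
    have h0 : C.adDivPow α m x y ≠ 0 := by
      rintro h0
      simp [h0] at hm
    refine hlt ?_ h0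
    rintro rfl
    exact h0 (by rw [adDivPow_zero, Matrix.one_apply_ne hxy])

/-- The only basis vectors whose image under `Ad (λ_α(t))` has a component in the Cartan subalgebra
are the simple coroots, which contribute themselves, and `X (-α)`, which contributes `t` times the
coroot of `α`. -/
theorem adRootGroup_mulVec_inl {R : Type*} [CommRing R] (α : H.root) (t : R)
    (v : b.support ⊕ H.root → R) (s : b.support) :
    (C.adRootGroup R α t).mulVec v (Sum.inl s) =
      v (Sum.inl s) + t * (C.corootCoord s α : R) * v (Sum.inr (negRoot α)) := by
  classical
  have : Nontrivial L := nontrivial_of_ne _ _ (C.basis.ne_zero (Sum.inr α))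
  have hL : 0 < finrank K L := finrank_pos
  have hE {m : ℕ} (hm : m ≠ 0) {y : b.support ⊕ H.root}
      (h : C.adDivPow α m (Sum.inl s) y ≠ 0) : m = 1 ∧ y = Sum.inr (negRoot α) :=
    eq_inr_negRoot_of_nsmul_root_add_basisWeight_eq_zero hm
      (C.basisWeight_eq_of_adDivPow_ne_zero h).symm
  have hA (y : b.support ⊕ H.root) : C.adRootGroup R α t (Sum.inl s) y =
      (if y = Sum.inl s then 1 else 0) +
        if y = Sum.inr (negRoot α) then t * (C.corootCoord s α : R) else 0 := by
    rw [adRootGroup_apply, ← Finset.sum_subset (Finset.range_subset_range.2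
      (show 2 ≤ finrank K L + 1 by omega)), Finset.sum_range_succ, Finset.sum_range_one]
    · rw [adDivPow_zero]
      congr 1
      · simp [Matrix.one_apply, eq_comm]
      · split_ifs with hy
        · rw [hy, adDivPow_one_inl, pow_one]
        · have h0 : C.adDivPow α 1 (Sum.inl s) y = 0 := by
            by_contra h
            exact hy (hE one_ne_zero h).2
          simp [h0]
    · intro m _ hm
      have h0 : C.adDivPow α m (Sum.inl s) y = 0 := by
        by_contra h
        rw [Finset.mem_range] at hm
        have := (hE (by omega) h).1
        omega
      simp [h0]
  simp only [Matrix.mulVec, dotProduct, hA, add_mul, ite_mul, one_mul, zero_mul,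
    Finset.sum_add_distrib, Finset.sum_ite_eq', Finset.mem_univ, if_true]

/-! ### The factorization of `φ` -/

variable {D : ℕ} (e : Fin D ≃ {α : H.root // b.IsPos α})

/-- The matrix over `k` whose columns are the coroots of the positive roots, in the basis of simple
coroots. -/
noncomputable def corootMatrix (k : Type*) [CommRing k] : Matrix b.support (Fin D) k :=
  Matrix.of fun s i => (C.corootCoord s (e i).1 : k)

/-- Applied to `Y_β`, the product `λ_{α_1}(x_1) ⋯ λ_{α_D}(x_D)` reaches the Cartan subalgebra
through some `λ_{α_i}(x_i)` acting on a multiple of `Y_{α_i}`, and the result is not moved back by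
the other factors. So `φ` is the matrix of the `x_i H_{α_i}` times the matrix of the coefficients of
`Y_{α_i}` in `λ_{α_{i+1}}(x_{i+1}) ⋯ λ_{α_D}(x_D) Y_β`, which is unitriangular for the height. -/
theorem exists_phi_eq_scaleColumns_mul (k : Type*) [CommRing k] :
    ∃ P : Matrix (Fin D) (Fin D) (MvPolynomial (Fin D) k), P.det = 1 ∧
      C.phi e (MvPolynomial (Fin D) k) MvPolynomial.X = scaleColumns (C.corootMatrix e k) * P := by
  classical
  obtain ⟨Q, hQ, h⟩ := exists_isUnitriangular_ofFn_prod_apply (S := Set.range Sum.inl)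
    (fun i => C.adRootGroup (MvPolynomial (Fin D) k) (e i).1 (MvPolynomial.X i))
    (fun i => C.isUnitriangular_adRootGroup (e i).2 _)
    (Sum.elim (fun s i => MvPolynomial.X i * (C.corootCoord s (e i).1 : MvPolynomial (Fin D) k))
      fun _ _ => 0)
    (fun i => Sum.inr (negRoot (e i).1))
    (by
      rintro _ ⟨s, rfl⟩ i v
      exact C.adRootGroup_mulVec_inl _ _ v s)
  refine ⟨Matrix.of fun i j => Q i (Sum.inr (negRoot (e i).1)) (Sum.inr (negRoot (e j).1)), ?_, ?_⟩
  · refine IsUnitriangular.det (ht := fun i => basisHeight b (Sum.inr (negRoot (e i).1)))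
      ⟨fun i => (hQ i).1 _, fun i j hij hne => (hQ i).2 _ _ (fun heq => hij ?_) hne⟩
    exact e.injective (Subtype.ext (negRoot_injective (Sum.inr_injective heq)))
  · ext1 s j
    have h1 := h (Sum.inl s) ⟨s, rfl⟩ (Sum.inr (negRoot (e j).1))
    rw [Matrix.one_apply_ne Sum.inl_ne_inr, zero_add] at h1
    simp only [phi, adUnipotent, Matrix.submatrix_apply, Matrix.mul_apply, scaleColumns,
      corootMatrix, Matrix.of_apply, map_intCast]
    convert h1 using 1
    rfl

theorem idealB_eq_maximalMinorsIdeal_scaleColumns [DecidableEq b.support] (k : Type*) [Field k] :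
    C.idealB e k = maximalMinorsIdeal (scaleColumns (C.corootMatrix e k)) := by
  obtain ⟨P, hP, h⟩ := C.exists_phi_eq_scaleColumns_mul e k
  rw [← maximalMinorsIdeal_mul_of_isUnit_det _ P (by rw [hP]; exact isUnit_one), ← h, idealB]
  congr!

end ChevalleyBasis

end Chevalley

section Root

variable {K L : Type*} [Field K] [CharZero K] [LieRing L] [LieAlgebra K L] [IsKilling K L]
  [FiniteDimensional K L] {H : LieSubalgebra K L} [H.IsCartanSubalgebra]
  [IsTriangularizable K H L] {b : (rootSystem H).Base}

/-! ### Minors of the matrix of coroots -/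

theorem linearIndependent_coroot_comp {ι : Type*} {g : ι → H.root} (hg : Function.Injective g)
    (h : LinearIndependent K fun j => (rootSystem H).root (g j)) :
    LinearIndependent K fun j => (coroot (g j).1 : H) :=
  (linearIndepOn_range_iff hg _).1
    ((rootSystem H).linearIndepOn_coroot_iff.2 ((linearIndepOn_range_iff hg _).2 h))

namespace ChevalleyBasis

variable (C : ChevalleyBasis b)

theorem sum_smul_coroot {ι : Type*} [Fintype ι] (g : ι → H.root) (w : ι → ℤ) :
    ∑ j, w j • (coroot (g j).1 : H) =
      ∑ s : b.support, (∑ j, C.corootCoord s (g j) * w j) • (coroot (s : H.root).1 : H) := by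
  simp_rw [Finset.sum_smul]
  rw [Finset.sum_comm]
  refine Finset.sum_congr rfl fun j _ => ?_
  conv_lhs => rw [C.coroot_eq_sum_corootCoord (g j)]
  rw [Finset.smul_sum]
  refine Finset.sum_congr rfl fun s _ => ?_
  rw [smul_smul, mul_comm]

variable [DecidableEq b.support] {g : b.support → H.root}

theorem det_corootCoord_ne_zero (hg : Function.Injective g)
    (hli : LinearIndependent K fun j => (rootSystem H).root (g j)) :
    (Matrix.of fun s j => C.corootCoord s (g j)).det ≠ 0 := by
  intro h
  obtain ⟨w, hw, h0⟩ := Matrix.exists_mulVec_eq_zero_iff.2 h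
  refine hw (funext fun j => ?_)
  have hsum : ∑ j, w j • (coroot (g j).1 : H) = 0 := by
    rw [C.sum_smul_coroot g w]
    exact Finset.sum_eq_zero fun s _ => by
      rw [show ∑ j, C.corootCoord s (g j) * w j = 0 from congrFun h0 s, zero_smul]
  exact Fintype.linearIndependent_iff.1
    ((linearIndependent_coroot_comp hg hli).restrict_scalars' ℤ) w hsum j

/-- If `p` divides the index of the subgroup generated by linearly independent coroots, one for each
simple root, in the coroot lattice, then the quotient has `p`-torsion: a vector in the kernel modulo
`p` lifts to a combination of these coroots that is `p` times an element of the lattice. -/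
theorem hasCorootTorsion_of_dvd_det {p : ℕ} (hp : p.Prime) (hg : Function.Injective g)
    (hli : LinearIndependent K fun j => (rootSystem H).root (g j))
    (h : (p : ℤ) ∣ (Matrix.of fun s j => C.corootCoord s (g j)).det) :
    HasCorootTorsion H p := by
  have : Fact p.Prime := ⟨hp⟩
  have hdet : ((Matrix.of fun s j => C.corootCoord s (g j)).map
      (Int.cast : ℤ → ZMod p)).det = 0 := by
    rw [← (ZMod.intCast_zmod_eq_zero_iff_dvd _ p).2 h]
    exact ((Int.castRingHom (ZMod p)).map_det _).symm
  obtain ⟨v, hv, h0⟩ := Matrix.exists_mulVec_eq_zero_iff.2 hdet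
  choose w hw using fun j => ZMod.intCast_surjective (v j)
  have hdvd (s : b.support) : (p : ℤ) ∣ ∑ j, C.corootCoord s (g j) * w j := by
    rw [← ZMod.intCast_zmod_eq_zero_iff_dvd]
    have := congrFun h0 s
    simpa [Matrix.mulVec, dotProduct, hw] using this
  choose u hu using hdvd
  have hsum : p • ∑ s : b.support, u s • (coroot (s : H.root).1 : H) =
      ∑ j, w j • (coroot (g j).1 : H) := by
    rw [C.sum_smul_coroot g w, Finset.smul_sum]
    refine Finset.sum_congr rfl fun s _ => ?_
    rw [hu s, mul_smul, natCast_zsmul]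
  have hcl (x : H) : x ∈ AddSubgroup.closure
      ((fun α : H.root => (coroot α.1 : H)) '' Set.range g) ↔
      ∃ c : b.support → ℤ, ∑ j, c j • (coroot (g j).1 : H) = x := by
    rw [← Set.range_comp, ← Submodule.span_int_eq_addSubgroupClosure,
      Submodule.mem_toAddSubgroup, Submodule.mem_span_range_iff_exists_fun]
    rfl
  refine ⟨Set.range g, ∑ s : b.support, u s • (coroot (s : H.root).1 : H), ?_, ?_, ?_⟩
  · exact sum_mem fun s _ =>
      zsmul_mem (AddSubgroup.subset_closure (Set.mem_range_self (s : H.root))) _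
  · rw [hcl]
    rintro ⟨c, hc⟩
    rw [← hc, ← sub_eq_zero, Finset.smul_sum, ← Finset.sum_sub_distrib] at hsum
    have hz : ∑ j, ((p : ℤ) * c j - w j) • (coroot (g j).1 : H) = 0 := by
      rw [← hsum]
      refine Finset.sum_congr rfl fun j _ => ?_
      rw [sub_smul, mul_smul, natCast_zsmul]
    refine hv (funext fun j => ?_)
    have hj := Fintype.linearIndependent_iff.1
      ((linearIndependent_coroot_comp hg hli).restrict_scalars' ℤ) _ hz j
    rw [← hw j, ← sub_eq_zero.1 hj]
    simp
  · rw [hcl, hsum]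
    exact ⟨w, rfl⟩

theorem cast_det_corootCoord_ne_zero (k : Type*) [Field k]
    (hk : ∀ p : ℕ, p.Prime → CharP k p → ¬ HasCorootTorsion H p) (hg : Function.Injective g)
    (hli : LinearIndependent K fun j => (rootSystem H).root (g j)) :
    ((Matrix.of fun s j => C.corootCoord s (g j)).det : k) ≠ 0 := by
  intro h
  obtain ⟨p, hp⟩ := CharP.exists k
  rw [CharP.intCast_eq_zero_iff k p] at h
  rcases CharP.char_is_prime_or_zero k p with hpp | rfl
  · exact hk p hpp hp (C.hasCorootTorsion_of_dvd_det hpp hg hli h)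
  · exact C.det_corootCoord_ne_zero hg hli (by simpa using h)

end ChevalleyBasis

/-! ### The Coxeter arrangement -/

section Coxeter

variable {D : ℕ} (e : Fin D ≃ {α : H.root // b.IsPos α})

theorem span_range_root_pos :
    Submodule.span K (Set.range fun i => (rootSystem H).root (e i).1) = ⊤ := by
  rw [eq_top_iff, ← RootPairing.IsRootSystem.span_root_eq_top (P := rootSystem H),
    ← RootPairing.rootSpan, ← b.span_root_support]
  refine Submodule.span_mono ?_
  rintro _ ⟨α, hα, rfl⟩
  exact ⟨e.symm ⟨α, b.isPos_of_mem_support hα⟩, by simp⟩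

theorem card_support_eq_finrank : Fintype.card b.support = finrank K H := by
  rw [← Subspace.dual_finrank_eq, finrank_eq_card_basis b.toWeightBasis]

/-- Each non-face contains `n` positive roots forming a basis of the dual of the Cartan subalgebra.
The corresponding minor of the matrix of coroots is invertible in `k`, so the product of the
corresponding variables lies in the ideal. -/
theorem stanleyReisnerIdeal_le_idealB [Nontrivial H] (C : ChevalleyBasis b) (k : Type*) [Field k]
    (hk : ∀ p : ℕ, p.Prime → CharP k p → ¬ HasCorootTorsion H p) :
    stanleyReisnerIdeal k (nerveComplex (coxeterArrangement e)) ≤ C.idealB e k := by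
  classical
  rw [C.idealB_eq_maximalMinorsIdeal_scaleColumns]
  refine Ideal.span_le.2 ?_
  rintro _ ⟨s, hs, hΔ, rfl⟩
  have hspan := (nonempty_and_notMem_nerveComplex_iff
    (f := fun i => (rootSystem H).root (e i).1) (fun i => (rootSystem H).ne_zero _)
    (span_range_root_pos e) s).1 ⟨hs, hΔ⟩
  obtain ⟨t, hts, hli, htop⟩ := exists_finset_subset_linearIndepOn_span_eq_top hspan
  have hcard : Fintype.card b.support = Fintype.card t := by
    rw [card_support_eq_finrank, Fintype.card_coe,
      card_eq_finrank_of_linearIndepOn_of_span_eq_top hli htop]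
  let f : b.support ≃ t := Fintype.equivOfCardEq hcard
  have hdet : ((C.corootMatrix e k).submatrix id fun j => (f j : Fin D)).det ≠ 0 := by
    have h := C.cast_det_corootCoord_ne_zero k hk (g := fun j => (e (f j)).1)
      (Subtype.val_injective.comp (e.injective.comp (Subtype.val_injective.comp f.injective)))
      (LinearIndependent.comp hli f f.injective)
    rw [← eq_intCast (Int.castRingHom k), RingHom.map_det] at h
    exact h
  have hmem := prod_X_mem_maximalMinorsIdeal_scaleColumns _ hdet
  rw [f.prod_comp (fun i : t => (MvPolynomial.X (i : Fin D) : MvPolynomial (Fin D) k)),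
    Finset.prod_coe_sort t] at hmem
  exact Ideal.mem_of_dvd _ (Finset.prod_dvd_prod_of_subset _ _ _ hts) hmem

end Coxeter

end Root

end LULU

theorem theorem4p1 {K L : Type*} [Field K] [CharZero K] [LieRing L] [LieAlgebra K L]
    [FiniteDimensional K L] [LieAlgebra.IsSimple K L]
    (H : LieSubalgebra K L) [H.IsCartanSubalgebra] [LieModule.IsTriangularizable K H L]
    (b : (LieAlgebra.IsKilling.rootSystem H).Base) (C : LULU.ChevalleyBasis b)
    {D : ℕ} (e : Fin D ≃ {α : H.root // b.IsPos α})
    (k : Type*) [Field k] :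
    LULU.IsMonomialIdeal (C.idealB e k) ∧
    ((∀ p : ℕ, p.Prime → CharP k p → ¬ LULU.HasCorootTorsion H p) →
      LULU.stanleyReisnerIdeal k (LULU.nerveComplex (LULU.coxeterArrangement e)) ≤
        C.idealB e k) ∧
    (∀ s : Finset (Fin D),
      LULU.IsMinimalNonface (LULU.nerveComplex (LULU.coxeterArrangement e)) s ↔
        s.card = Module.finrank K H ∧
        LinearIndepOn K (fun i => LieModule.Weight.toLinear K H L (e i).1.1) (s : Set (Fin D)) ∧
        Submodule.span K ((fun i => LieModule.Weight.toLinear K H L (e i).1.1) '' (s : Set (Fin D)))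
          = ⊤) := by
  classical
  have : Nontrivial L := by
    by_contra h
    rw [not_nontrivial_iff_subsingleton] at h
    exact LieAlgebra.IsSimple.non_abelian K (L := L) ⟨fun _ _ => Subsingleton.elim _ _⟩
  have : Nontrivial H := inferInstance
  refine ⟨?_, LULU.stanleyReisnerIdeal_le_idealB e C k, fun s => ?_⟩
  · rw [C.idealB_eq_maximalMinorsIdeal_scaleColumns]
    exact LULU.isMonomialIdeal_maximalMinorsIdeal_scaleColumns _
  · have h := LULU.isMinimalNonface_nerveComplex_iff
      (f := fun i => (rootSystem H).root (e i).1) (fun i => (rootSystem H).ne_zero _)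
      (LULU.span_range_root_pos e) s
    exact h.trans ⟨fun h => ⟨LULU.card_eq_finrank_of_linearIndepOn_of_span_eq_top h.1 h.2, h⟩,
      fun h => h.2⟩
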